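/- **Setting.** Fix three disjoint countably infinite sets of symbols: numerals $\overline n$ (one for each integer $n$), symbolic constants, and general variables; fix also a countably infinite set of integer variables. Precomputed terms are the numerals and the symbolic constants. They are totally ordered so that $\overline m<\overline n$ iff $m<n$, and every precomputed term between two numerals is a numeral. **Regular programs.** Regular terms are formed from numerals and general variables by $+,-,\times$. A regular atom is $p(\mathbf t)$, where $p$ is a symbolic constant and $\mathbf t$ is a tuple of symbolic constants and regular terms. A regular rule is $\mathit{Head}\leftarrow\mathit{Body}$, where $\mathit{Head}$ is a regular atom $p(\mathbf t)$ (basic rule), a regular atom in braces $\{p(\mathbf t)\}$ (choice rule), or empty (constraint), and $\mathit{Body}$ is a finite, possibly empty, conjunction of expressions of the forms $A$ and $\mathit{not}\ A$ ($A$ a regular atom), $t_1\prec t_2$ (each $t_i$ a symbolic constant or a regular term, $\prec$ one of $=,\neq,<,>,\leq,\geq$), and $t_1=t_2\,..\,t_3$ (each $t_i$ a regular term). A regular program $\Pi$ is a finite set of regular rules. A predicate symbol $p/n$ occurs in $\Pi$ if some atom $p(t_1,\dots,t_n)$ occurs in a rule of $\Pi$. The Herbrand base of $\Pi$ is the set of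 all atoms $p(t_1,\dots,t_n)$ with $p/n$ occurring in $\Pi$ and $t_1,\dots,t_n$ precomputed. The program $\Pi$ is tight if the following directed graph on the predicate symbols occurring in $\Pi$ has no directed cycles (loops included): there is an edge from $p/n$ to $q/m$ whenever some rule of $\Pi$ has a head $p(t_1,\dots,t_n)$ or $\{p(t_1,\dots,t_n)\}$ and a non-negated atom $q(t'_1,\dots,t'_m)$ as a conjunctive term of its body. **Stable models** (Abstract Gringo). The set $[t]$ of values of a ground term is defined by $[t]=\{t\}$ if $t$ is precomputed; $[t_1+t_2]=\{\overline{m+n}:\overline m\in[t_1],\overline n\in[t_2]\}$, and similarly for $-$ and $\times$; $[t_1\,..\,t_2]=\{\overline k:\overline m\in[t_1],\overline n\in[t_2],m\leq k\leq n\}$. For a tuple, $[t_1,\dots,t_n]=[t_1]\times\cdots\times[t_n]$. For ground expressions, $\tau(p(\mathbf t))=\bigvee_{\mathbf r\in[\mathbf t]}p(\mathbf r)$ and $\tau(\mathit{not}\ p(\mathbf t))=\bigvee_{\mathbf r\in[\mathbf t]}\neg p(\mathbf r)$ in a body; $\tau$ of a comparison is $\top$ if the relation holds between some values of its two sides, and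 $\bot$ otherwise; $\tau$ of a body is the conjunction of $\tau$ of its conjunctive terms. The rules $p(\mathbf t)\leftarrow\mathit{Body}$, $\{p(\mathbf t)\}\leftarrow\mathit{Body}$ and $\leftarrow\mathit{Body}$ become $\tau(\mathit{Body})\to\bigwedge_{\mathbf r\in[\mathbf t]}p(\mathbf r)$, $\tau(\mathit{Body})\to\bigwedge_{\mathbf r\in[\mathbf t]}(p(\mathbf r)\lor\neg p(\mathbf r))$ and $\neg\tau(\mathit{Body})$. Let $\tau\Pi$ be the set of these infinitary propositional formulas for all ground instances of rules of $\Pi$ (variables are replaced by precomputed terms). A set $S$ of ground atoms with precomputed arguments is a stable model of $\Pi$ if it is minimal with respect to inclusion among the sets satisfying the reducts $F^S$ of all $F\in\tau\Pi$, where $F^S$ is obtained from $F$ by replacing by $\bot$ the maximal subformulas not satisfied by $S$. **Natural completion.** Formulas are two-sorted, with the sort general and its subsort integer. Numerals are constants of sort integer, symbolic constants are constants of sort general; $+,-,\times$ are functions on sort integer; the predicate symbols occurring in $\Pi$ and $\neq,<,>,\leq,\geq$ take arguments of sort general. A variable is critical in a rule $R$ if it has in $R$ an occurrence in the scope of an arithmetic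 operation or in a comparison $t_1=t_2\,..\,t_3$. For each rule $R$ choose a function $f_R$ mapping the critical variables of $R$ to pairwise distinct integer variables. Extend it to tuples, atoms and comparisons without intervals by replacing each critical variable $X$ by $f_R(X)$, and put $f_R(\mathit{not}\ A)=\neg f_R(A)$, $f_R(t_1=t_2\,..\,t_3)=f_R(t_2)\leq f_R(t_1)\land f_R(t_1)\leq f_R(t_3)$, $f_R(B_1\land B_2\land\cdots)=f_R(B_1)\land f_R(B_2)\land\cdots$. For $p/n$ occurring in $\Pi$, let $D$ be the set of rules of $\Pi$ with a head $p(\mathbf t)$ or $\{p(\mathbf t)\}$, $\mathbf t$ of length $n$, and choose a tuple $\mathbf V$ of $n$ distinct general variables not occurring in $\Pi$. The completed definition of $p/n$ is $$\forall\mathbf V\Bigl(p(\mathbf V)\leftrightarrow\bigvee_{R\in D}\exists\mathbf U_R\,F_R\Bigr),$$ where $F_R$ is $f_R(\mathit{Body})\land\mathbf V=f_R(\mathbf t)$ if $R$ is basic, and $f_R(\mathit{Body})\land\mathbf V=f_R(\mathbf t)\land p(\mathbf V)$ if $R$ is a choice rule, and $\mathbf U_R$ lists all variables occurring in $f_R(\mathit{Body})$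 or $f_R(\mathbf t)$. The natural completion $\mathrm{NCOMP}(\Pi)$ consists of the completed definitions of all predicate symbols occurring in $\Pi$ and, for every constraint $R={}\leftarrow\mathit{Body}$ of $\Pi$, the universal closure of $\neg f_R(\mathit{Body})$. **Standard interpretation.** For a subset $S$ of the Herbrand base of $\Pi$, $S^\uparrow$ is the interpretation in which the sorts general and integer range over all precomputed terms and over all numerals, respectively, each precomputed term denotes itself, arithmetic operations are those on integers, comparison symbols are interpreted by the order on precomputed terms, and $p(\mathbf t)$, for a tuple $\mathbf t$ of precomputed terms, is true iff $p(\mathbf t)\in S$. **Theorem.** For any tight regular program $\Pi$ and any subset $S$ of its Herbrand base, $S$ is a stable model of $\Pi$ if and only if $S^\uparrow$ satisfies $\mathrm{NCOMP}(\Pi)$ (whatever choices of $f_R$ and $\mathbf V$ are made). -/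

import Mathlib

namespace NatCompletion

/-! ## Precomputed terms -/

/-- Precomputed terms: numerals (one for every integer) and symbolic constants. -/
inductive Precomputed (C : Type) : Type
  | num (n : ℤ) : Precomputed C
  | sym (c : C) : Precomputed C

/-- The conditions on the chosen total order of the precomputed terms. -/
structure StandardOrder (C : Type) [LinearOrder (Precomputed C)] : Prop where
  num_lt_num : ∀ m n : ℤ, (Precomputed.num m : Precomputed C) < Precomputed.num n ↔ m < n
  between : ∀ (m n : ℤ) (t : Precomputed C),
    Precomputed.num m < t → t < Precomputed.num n → ∃ k : ℤ, t = Precomputed.num k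

/-- The comparison symbols other than equality. -/
inductive Rel : Type
  | ne | lt | gt | le | ge

/-- The relation on a linearly ordered set denoted by a comparison symbol. -/
def Rel.Holds {T : Type} [LinearOrder T] : Rel → T → T → Prop
  | .ne, a, b => a ≠ b
  | .lt, a, b => a < b
  | .gt, a, b => a > b
  | .le, a, b => a ≤ b
  | .ge, a, b => a ≥ b

/-- A predicate symbol `p/n`. -/
abbrev PredSym (C : Type) : Type := C × ℕ

/-! ## Regular programs

`C` is the set of symbolic constants, `V` is the set of (general) variables. -/

/-- Regular terms. -/
inductive RegTerm (V : Type) : Type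
  | num (n : ℤ) : RegTerm V
  | var (X : V) : RegTerm V
  | add (s t : RegTerm V) : RegTerm V
  | sub (s t : RegTerm V) : RegTerm V
  | mul (s t : RegTerm V) : RegTerm V

/-- A symbolic constant or a regular term. -/
inductive Arg (C V : Type) : Type
  | sym (c : C) : Arg C V
  | reg (t : RegTerm V) : Arg C V

/-- A regular atom `p(t)`. -/
structure RegAtom (C V : Type) : Type where
  pred : C
  args : List (Arg C V)

/-- The conjunctive terms of the body of a regular rule. -/
inductive BodyLit (C V : Type) : Type
  /-- `p(t)` -/
  | pos (A : RegAtom C V) : BodyLit C V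
  /-- `not p(t)` -/
  | neg (A : RegAtom C V) : BodyLit C V
  /-- `t₁ = t₂` -/
  | eq (t₁ t₂ : Arg C V) : BodyLit C V
  /-- `t₁ ≺ t₂`, where `≺` is a comparison symbol different from `=` -/
  | rel (r : Rel) (t₁ t₂ : Arg C V) : BodyLit C V
  /-- `t₁ = t₂ .. t₃` -/
  | interval (t₁ t₂ t₃ : RegTerm V) : BodyLit C V

/-- The head of a regular rule: an atom, an atom in braces, or empty. -/
inductive Head (C V : Type) : Type
  | basic (A : RegAtom C V) : Head C V
  | choice (A : RegAtom C V) : Head C V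
  | constraint : Head C V

/-- Regular rules. -/
structure Rule (C V : Type) : Type where
  head : Head C V
  body : List (BodyLit C V)

/-- A regular program is a finite set of regular rules. -/
abbrev Program (C V : Type) : Type := Finset (Rule C V)

section Syntactic

variable {C V : Type}

/-- The variables occurring in a regular term. -/
def RegTerm.vars : RegTerm V → Set V
  | .num _ => ∅
  | .var X => {X}
  | .add s t => s.vars ∪ t.vars
  | .sub s t => s.vars ∪ t.vars
  | .mul s t => s.vars ∪ t.vars

/-- The variables with an occurrence in the scope of an arithmetic operation. -/
def RegTerm.opVars : RegTerm V → Set V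
  | .num _ => ∅
  | .var _ => ∅
  | .add s t => s.vars ∪ t.vars
  | .sub s t => s.vars ∪ t.vars
  | .mul s t => s.vars ∪ t.vars

def Arg.vars : Arg C V → Set V
  | .sym _ => ∅
  | .reg t => t.vars

def Arg.opVars : Arg C V → Set V
  | .sym _ => ∅
  | .reg t => t.opVars

def RegAtom.vars (A : RegAtom C V) : Set V := {X | ∃ t ∈ A.args, X ∈ t.vars}

def RegAtom.opVars (A : RegAtom C V) : Set V := {X | ∃ t ∈ A.args, X ∈ t.opVars}

/-- The predicate symbol `p/n` of an atom `p(t₁,…,tₙ)`. -/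
def RegAtom.predSym (A : RegAtom C V) : PredSym C := (A.pred, A.args.length)

/-- The variables occurring in a conjunctive term of a body. -/
def BodyLit.vars : BodyLit C V → Set V
  | .pos A => A.vars
  | .neg A => A.vars
  | .eq t₁ t₂ => t₁.vars ∪ t₂.vars
  | .rel _ t₁ t₂ => t₁.vars ∪ t₂.vars
  | .interval t₁ t₂ t₃ => t₁.vars ∪ t₂.vars ∪ t₃.vars

/-- The variables that a conjunctive term of the body makes critical: those in the scope of an
arithmetic operation and those that are part of a comparison `t₁ = t₂ .. t₃`. -/
def BodyLit.critical : BodyLit C V → Set V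
  | .pos A => A.opVars
  | .neg A => A.opVars
  | .eq t₁ t₂ => t₁.opVars ∪ t₂.opVars
  | .rel _ t₁ t₂ => t₁.opVars ∪ t₂.opVars
  | .interval t₁ t₂ t₃ => t₁.vars ∪ t₂.vars ∪ t₃.vars

/-- `H.IsFor A` means that the head `H` is `A` or `{A}`. -/
def Head.IsFor (H : Head C V) (A : RegAtom C V) : Prop :=
  H = Head.basic A ∨ H = Head.choice A

/-- The variables occurring in a rule. -/
def Rule.vars (R : Rule C V) : Set V :=
  {X | (∃ A, R.head.IsFor A ∧ X ∈ A.vars) ∨ ∃ B ∈ R.body, X ∈ B.vars}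

/-- The critical variables of a rule. -/
def Rule.critical (R : Rule C V) : Set V :=
  {X | (∃ A, R.head.IsFor A ∧ X ∈ A.opVars) ∨ ∃ B ∈ R.body, X ∈ B.critical}

/-- The atom `A` occurs in the rule `R`. -/
def Rule.HasAtom (R : Rule C V) (A : RegAtom C V) : Prop :=
  R.head.IsFor A ∨ BodyLit.pos A ∈ R.body ∨ BodyLit.neg A ∈ R.body

/-- The predicate symbol `P` occurs in the program. -/
def Program.Occurs (Pi : Program C V) (P : PredSym C) : Prop :=
  ∃ R ∈ Pi, ∃ A, R.HasAtom A ∧ A.predSym = P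

/-- The edges of the positive predicate dependency graph. -/
def Program.DepEdge (Pi : Program C V) (P Q : PredSym C) : Prop :=
  ∃ R ∈ Pi, (∃ A, R.head.IsFor A ∧ A.predSym = P) ∧
    ∃ B, BodyLit.pos B ∈ R.body ∧ B.predSym = Q

/-- A program is tight if its positive predicate dependency graph has no directed cycles
(loops included). -/
def Program.Tight (Pi : Program C V) : Prop :=
  ∀ P, ¬ Relation.TransGen Pi.DepEdge P P

end Syntactic

/-! ## Infinitary propositional formulas and their stable models -/

/-- Infinitary propositional formulas over a set of atoms. -/
inductive InfForm (A : Type) : Type 1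
  | atom (a : A) : InfForm A
  | bot : InfForm A
  | conj {ι : Type} (F : ι → InfForm A) : InfForm A
  | disj {ι : Type} (F : ι → InfForm A) : InfForm A
  | imp (F G : InfForm A) : InfForm A

namespace InfForm

variable {A : Type}

def neg (F : InfForm A) : InfForm A := imp F bot

def top : InfForm A := imp bot bot

def or (F G : InfForm A) : InfForm A := disj fun b : Bool => cond b F G

/-- Satisfaction of an infinitary formula by a set of atoms. -/
def Sat (I : Set A) : InfForm A → Prop
  | atom a => a ∈ I
  | bot => False
  | conj F => ∀ i, Sat I (F i)
  | disj F => ∃ i, Sat I (F i)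
  | imp F G => Sat I F → Sat I G

open Classical in
/-- The reduct of a formula relative to `I`: subformulas that `I` does not satisfy become `⊥`. -/
noncomputable def reduct (I : Set A) : InfForm A → InfForm A
  | atom a => if a ∈ I then atom a else bot
  | bot => bot
  | conj F => if Sat I (conj F) then conj fun i => reduct I (F i) else bot
  | disj F => if Sat I (disj F) then disj fun i => reduct I (F i) else bot
  | imp F G => if Sat I (imp F G) then imp (reduct I F) (reduct I G) else bot

/-- `I` is a stable model of `H` if it is minimal with respect to inclusion among the sets that
satisfy the reducts of all members of `H` relative to `I`. -/
def IsStable (H : Set (InfForm A)) (I : Set A) : Prop :=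
  Minimal (fun J : Set A => ∀ F ∈ H, Sat J (reduct I F)) I

end InfForm

/-! ## Stable models of regular programs (the semantics of Abstract Gringo) -/

/-- Ground atoms whose arguments are precomputed terms. -/
structure GroundAtom (C : Type) : Type where
  pred : C
  args : List (Precomputed C)

section Stable

variable {C V : Type}

/-- The Herbrand base of a program. -/
def Program.herbrandBase (Pi : Program C V) : Set (GroundAtom C) :=
  {a | Pi.Occurs (a.pred, a.args.length)}

/-- The set of values of the ground term obtained from `t` by the substitution `θ`;
an arithmetic operation has values only on numerals. -/
def RegTerm.values (θ : V → Precomputed C) : RegTerm V → Set (Precomputed C)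
  | .num n => {Precomputed.num n}
  | .var X => {θ X}
  | .add s t => {r | ∃ m n : ℤ, Precomputed.num m ∈ s.values θ ∧ Precomputed.num n ∈ t.values θ ∧
      r = Precomputed.num (m + n)}
  | .sub s t => {r | ∃ m n : ℤ, Precomputed.num m ∈ s.values θ ∧ Precomputed.num n ∈ t.values θ ∧
      r = Precomputed.num (m - n)}
  | .mul s t => {r | ∃ m n : ℤ, Precomputed.num m ∈ s.values θ ∧ Precomputed.num n ∈ t.values θ ∧
      r = Precomputed.num (m * n)}

/-- The set of values of the interval `s .. t` under the substitution `θ`. -/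
def intervalValues (θ : V → Precomputed C) (s t : RegTerm V) : Set (Precomputed C) :=
  {r | ∃ m n k : ℤ, Precomputed.num m ∈ s.values θ ∧ Precomputed.num n ∈ t.values θ ∧
    m ≤ k ∧ k ≤ n ∧ r = Precomputed.num k}

def Arg.values (θ : V → Precomputed C) : Arg C V → Set (Precomputed C)
  | .sym c => {Precomputed.sym c}
  | .reg t => t.values θ

/-- The set of values of a tuple. -/
def tupleValues (θ : V → Precomputed C) (ts : List (Arg C V)) : Set (List (Precomputed C)) :=
  {rs | List.Forall₂ (fun r t => r ∈ Arg.values θ t) rs ts}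

open Classical in
/-- The infinitary formula `⊤` or `⊥`, depending on whether `p` holds. -/
noncomputable def truthValue (p : Prop) : InfForm (GroundAtom C) :=
  if p then InfForm.top else InfForm.bot

variable [LinearOrder (Precomputed C)]

/-- The translation of an instance of a conjunctive term of a body. -/
noncomputable def BodyLit.tau (θ : V → Precomputed C) : BodyLit C V → InfForm (GroundAtom C)
  | .pos A => InfForm.disj fun rs : {rs // rs ∈ tupleValues θ A.args} =>
      InfForm.atom ⟨A.pred, rs.1⟩
  | .neg A => InfForm.disj fun rs : {rs // rs ∈ tupleValues θ A.args} =>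
      InfForm.neg (InfForm.atom ⟨A.pred, rs.1⟩)
  | .eq t₁ t₂ => truthValue (∃ r₁ ∈ t₁.values θ, ∃ r₂ ∈ t₂.values θ, r₁ = r₂)
  | .rel c t₁ t₂ => truthValue (∃ r₁ ∈ t₁.values θ, ∃ r₂ ∈ t₂.values θ, c.Holds r₁ r₂)
  | .interval t₁ t₂ t₃ =>
      truthValue (∃ r₁ ∈ t₁.values θ, ∃ r₂ ∈ intervalValues θ t₂ t₃, r₁ = r₂)

/-- The translation of an instance of the body of a rule. -/
noncomputable def Rule.tauBody (θ : V → Precomputed C) (R : Rule C V) : InfForm (GroundAtom C) :=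
  InfForm.conj fun B : {B // B ∈ R.body} => B.1.tau θ

/-- The translation of the instance of a rule obtained by the substitution `θ`. -/
noncomputable def Rule.tau (θ : V → Precomputed C) (R : Rule C V) : InfForm (GroundAtom C) :=
  match R.head with
  | .basic A => InfForm.imp (R.tauBody θ)
      (InfForm.conj fun rs : {rs // rs ∈ tupleValues θ A.args} => InfForm.atom ⟨A.pred, rs.1⟩)
  | .choice A => InfForm.imp (R.tauBody θ)
      (InfForm.conj fun rs : {rs // rs ∈ tupleValues θ A.args} =>
        InfForm.or (InfForm.atom ⟨A.pred, rs.1⟩) (InfForm.neg (InfForm.atom ⟨A.pred, rs.1⟩)))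
  | .constraint => InfForm.neg (R.tauBody θ)

/-- The translation of a program: the translations of all instances of its rules. -/
noncomputable def Program.tau (Pi : Program C V) : Set (InfForm (GroundAtom C)) :=
  {F | ∃ R ∈ Pi, ∃ θ : V → Precomputed C, F = R.tau θ}

/-- `S` is a stable model of the program. -/
def Program.IsStableModel (Pi : Program C V) (S : Set (GroundAtom C)) : Prop :=
  InfForm.IsStable Pi.tau S

end Stable

/-! ## Two-sorted formulas

`C` is the set of symbolic constants, `V` and `W` are the sets of general and of integer
variables. -/

/-- Terms of the sort *integer*. -/
inductive IntTerm (W : Type) : Type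
  | num (n : ℤ) : IntTerm W
  | var (N : W) : IntTerm W
  | add (s t : IntTerm W) : IntTerm W
  | sub (s t : IntTerm W) : IntTerm W
  | mul (s t : IntTerm W) : IntTerm W

/-- Terms of the sort *general*; *integer* is a subsort. -/
inductive GenTerm (C V W : Type) : Type
  | sym (c : C) : GenTerm C V W
  | var (X : V) : GenTerm C V W
  | int (t : IntTerm W) : GenTerm C V W

/-- Two-sorted first-order formulas. An atomic formula `atom p [t₁, …, tₙ]` is formed with the
predicate symbol `p/n`. -/
inductive Formula (C V W : Type) : Type
  | atom (p : C) (ts : List (GenTerm C V W)) : Formula C V W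
  | eq (s t : GenTerm C V W) : Formula C V W
  | rel (r : Rel) (s t : GenTerm C V W) : Formula C V W
  | top : Formula C V W
  | bot : Formula C V W
  | neg (F : Formula C V W) : Formula C V W
  | and (F G : Formula C V W) : Formula C V W
  | or (F G : Formula C V W) : Formula C V W
  | iff (F G : Formula C V W) : Formula C V W
  | allG (X : V) (F : Formula C V W) : Formula C V W
  | exG (X : V) (F : Formula C V W) : Formula C V W
  | allI (N : W) (F : Formula C V W) : Formula C V W
  | exI (N : W) (F : Formula C V W) : Formula C V W

/-- Interpretations of the two-sorted signature. -/
structure Interpretation (C : Type) : Type 1 where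
  /-- the universe of the sort *general* -/
  Gen : Type
  /-- the universe of the sort *integer* -/
  Int : Type
  /-- the inclusion of the universe of the subsort -/
  incl : Int → Gen
  incl_injective : Function.Injective incl
  num : ℤ → Int
  sym : C → Gen
  add : Int → Int → Int
  sub : Int → Int → Int
  mul : Int → Int → Int
  rel : Rel → Gen → Gen → Prop
  /-- `pred p` restricted to lists of length `n` is the extent of `p/n` -/
  pred : C → List Gen → Prop

section Semantics

variable {C V W : Type}

def IntTerm.eval (J : Interpretation C) (w : W → J.Int) : IntTerm W → J.Int
  | .num n => J.num n
  | .var N => w N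
  | .add s t => J.add (s.eval J w) (t.eval J w)
  | .sub s t => J.sub (s.eval J w) (t.eval J w)
  | .mul s t => J.mul (s.eval J w) (t.eval J w)

def GenTerm.eval (J : Interpretation C) (v : V → J.Gen) (w : W → J.Int) :
    GenTerm C V W → J.Gen
  | .sym c => J.sym c
  | .var X => v X
  | .int t => J.incl (t.eval J w)

open Classical in
/-- Satisfaction of a formula under an assignment of values to general and integer variables. -/
noncomputable def Formula.Holds (J : Interpretation C) :
    (V → J.Gen) → (W → J.Int) → Formula C V W → Prop
  | v, w, .atom p ts => J.pred p (ts.map (GenTerm.eval J v w))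
  | v, w, .eq s t => s.eval J v w = t.eval J v w
  | v, w, .rel r s t => J.rel r (s.eval J v w) (t.eval J v w)
  | _, _, .top => True
  | _, _, .bot => False
  | v, w, .neg F => ¬ F.Holds J v w
  | v, w, .and F G => F.Holds J v w ∧ G.Holds J v w
  | v, w, .or F G => F.Holds J v w ∨ G.Holds J v w
  | v, w, .iff F G => F.Holds J v w ↔ G.Holds J v w
  | v, w, .allG X F => ∀ a, F.Holds J (Function.update v X a) w
  | v, w, .exG X F => ∃ a, F.Holds J (Function.update v X a) w
  | v, w, .allI N F => ∀ a, F.Holds J v (Function.update w N a)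
  | v, w, .exI N F => ∃ a, F.Holds J v (Function.update w N a)

/-- `J` satisfies all members of a set of sentences. -/
def Interpretation.Satisfies (J : Interpretation C) (T : Set (Formula C V W)) : Prop :=
  ∀ F ∈ T, ∀ (v : V → J.Gen) (w : W → J.Int), F.Holds J v w

/-- The standard interpretation `S^↑`; numerals are identified with integers in the universe of
the sort *integer*. -/
def up [LinearOrder (Precomputed C)] (S : Set (GroundAtom C)) : Interpretation C where
  Gen := Precomputed C
  Int := ℤ
  incl := Precomputed.num
  incl_injective := fun _ _ h => Precomputed.num.inj h
  num := fun n => n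
  sym := Precomputed.sym
  add := fun m n => m + n
  sub := fun m n => m - n
  mul := fun m n => m * n
  rel := Rel.Holds
  pred := fun p rs => (⟨p, rs⟩ : GroundAtom C) ∈ S

end Semantics

section FormulaSyntax

variable {C V W : Type}

open Classical in
/-- The integer variables of a term. -/
noncomputable def IntTerm.ivars : IntTerm W → Finset W
  | .num _ => ∅
  | .var N => {N}
  | .add s t => s.ivars ∪ t.ivars
  | .sub s t => s.ivars ∪ t.ivars
  | .mul s t => s.ivars ∪ t.ivars

noncomputable def GenTerm.ivars : GenTerm C V W → Finset W
  | .sym _ => ∅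
  | .var _ => ∅
  | .int t => t.ivars

/-- The general variables of a term. -/
def GenTerm.gvars : GenTerm C V W → Finset V
  | .sym _ => ∅
  | .var X => {X}
  | .int _ => ∅

open Classical in
noncomputable def tupleGvars (ts : List (GenTerm C V W)) : Finset V :=
  ts.toFinset.biUnion GenTerm.gvars

open Classical in
noncomputable def tupleIvars (ts : List (GenTerm C V W)) : Finset W :=
  ts.toFinset.biUnion GenTerm.ivars

open Classical in
/-- The free general variables of a formula. -/
noncomputable def Formula.gfree : Formula C V W → Finset V
  | .atom _ ts => tupleGvars ts
  | .eq s t => s.gvars ∪ t.gvars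
  | .rel _ s t => s.gvars ∪ t.gvars
  | .top => ∅
  | .bot => ∅
  | .neg F => F.gfree
  | .and F G => F.gfree ∪ G.gfree
  | .or F G => F.gfree ∪ G.gfree
  | .iff F G => F.gfree ∪ G.gfree
  | .allG X F => F.gfree.erase X
  | .exG X F => F.gfree.erase X
  | .allI _ F => F.gfree
  | .exI _ F => F.gfree

open Classical in
/-- The free integer variables of a formula. -/
noncomputable def Formula.ifree : Formula C V W → Finset W
  | .atom _ ts => tupleIvars ts
  | .eq s t => s.ivars ∪ t.ivars
  | .rel _ s t => s.ivars ∪ t.ivars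
  | .top => ∅
  | .bot => ∅
  | .neg F => F.ifree
  | .and F G => F.ifree ∪ G.ifree
  | .or F G => F.ifree ∪ G.ifree
  | .iff F G => F.ifree ∪ G.ifree
  | .allG _ F => F.ifree
  | .exG _ F => F.ifree
  | .allI N F => F.ifree.erase N
  | .exI N F => F.ifree.erase N

/-- The conjunction of a list of formulas. -/
def Formula.conj (Fs : List (Formula C V W)) : Formula C V W := Fs.foldr Formula.and Formula.top

/-- The disjunction of a list of formulas. -/
def Formula.disj (Fs : List (Formula C V W)) : Formula C V W := Fs.foldr Formula.or Formula.bot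

/-- Prefixing a formula with universal or existential quantifiers over a list of variables. -/
def Formula.allGs (Xs : List V) (F : Formula C V W) : Formula C V W := Xs.foldr Formula.allG F

def Formula.exGs (Xs : List V) (F : Formula C V W) : Formula C V W := Xs.foldr Formula.exG F

def Formula.allIs (Ns : List W) (F : Formula C V W) : Formula C V W := Ns.foldr Formula.allI F

def Formula.exIs (Ns : List W) (F : Formula C V W) : Formula C V W := Ns.foldr Formula.exI F

/-- The universal closure of a formula. -/
noncomputable def Formula.closure (F : Formula C V W) : Formula C V W :=
  Formula.allGs F.gfree.toList (Formula.allIs F.ifree.toList F)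

/-- The equality between two tuples of terms of the same length. -/
def tupleEq (ss ts : List (GenTerm C V W)) : Formula C V W :=
  Formula.conj (List.zipWith Formula.eq ss ts)

end FormulaSyntax

/-! ## Natural completion -/

section Completion

variable {C V W : Type}

/-- The result of replacing every variable `X` of a regular term by the integer variable `f X`.
It is applied only where all variables of the term are critical. -/
def RegTerm.toInt (f : V → W) : RegTerm V → IntTerm W
  | .num n => .num n
  | .var X => .var (f X)
  | .add s t => .add (s.toInt f) (t.toInt f)
  | .sub s t => .sub (s.toInt f) (t.toInt f)
  | .mul s t => .mul (s.toInt f) (t.toInt f)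

open Classical in
/-- The result of replacing every variable `X` in the set `K` by the integer variable `f X`. -/
noncomputable def Arg.replace (K : Set V) (f : V → W) : Arg C V → GenTerm C V W
  | .sym c => .sym c
  | .reg (.var X) => if X ∈ K then .int (.var (f X)) else .var X
  | .reg t => .int (t.toInt f)

/-- `f_R(t)` for a tuple `t`, where `K` is the set of critical variables of `R`. -/
noncomputable def replaceTuple (K : Set V) (f : V → W) (ts : List (Arg C V)) :
    List (GenTerm C V W) :=
  ts.map (Arg.replace K f)

/-- `f_R(B)` for a conjunctive term `B` of the body of `R`, where `K` is the set of critical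
variables of `R`. -/
noncomputable def BodyLit.replace (K : Set V) (f : V → W) : BodyLit C V → Formula C V W
  | .pos A => .atom A.pred (replaceTuple K f A.args)
  | .neg A => .neg (.atom A.pred (replaceTuple K f A.args))
  | .eq t₁ t₂ => .eq (t₁.replace K f) (t₂.replace K f)
  | .rel r t₁ t₂ => .rel r (t₁.replace K f) (t₂.replace K f)
  | .interval t₁ t₂ t₃ => .and (.rel .le (.int (t₂.toInt f)) (.int (t₁.toInt f)))
      (.rel .le (.int (t₁.toInt f)) (.int (t₃.toInt f)))

/-- `f_R(Body)` for the body of `R`. -/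
noncomputable def Rule.bodyFormula (R : Rule C V) (f : V → W) : Formula C V W :=
  Formula.conj (R.body.map (BodyLit.replace R.critical f))

/-- The arbitrary choices made in the construction of the natural completion: a function `f_R`
for every rule, and a tuple of fresh general variables for every predicate symbol. -/
structure Choices (W : Type) (Pi : Program C V) : Type where
  f : Rule C V → V → W
  f_injOn : ∀ R ∈ Pi, Set.InjOn (f R) R.critical
  tuple : PredSym C → List V
  length_tuple : ∀ P, Pi.Occurs P → (tuple P).length = P.2
  nodup_tuple : ∀ P, Pi.Occurs P → (tuple P).Nodup
  fresh_tuple : ∀ P, Pi.Occurs P → ∀ X ∈ tuple P, ∀ R ∈ Pi, X ∉ R.vars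

open Classical in
/-- The definition of a predicate symbol in a program. -/
noncomputable def Program.definition (Pi : Program C V) (P : PredSym C) : Finset (Rule C V) :=
  Pi.filter fun R => ∃ A, R.head.IsFor A ∧ A.predSym = P

open Classical in
/-- The formula `∃ U_R F_R` for a rule `R` with the head `A` or `{A}`. The argument `extra` is the
conjunctive term that is added to `F_R` for choice rules. -/
noncomputable def Rule.existsFormula (R : Rule C V) (f : V → W) (Vs : List V)
    (A : RegAtom C V) (extra : Option (Formula C V W)) : Formula C V W :=
  let body := R.bodyFormula f
  let ts := replaceTuple R.critical f A.args
  let core := Formula.and body (tupleEq (Vs.map GenTerm.var) ts)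
  Formula.exGs (body.gfree ∪ tupleGvars ts).toList
    (Formula.exIs (body.ifree ∪ tupleIvars ts).toList
      (match extra with
        | none => core
        | some G => Formula.and core G))

/-- The disjunctive term `∃ U_R F_R` of a completed definition that corresponds to `R`
(constraints do not belong to the definition of any predicate symbol). -/
noncomputable def Rule.disjunct (R : Rule C V) (f : V → W) (Vs : List V) : Formula C V W :=
  match R.head with
  | .basic A => R.existsFormula f Vs A none
  | .choice A => R.existsFormula f Vs A (some (Formula.atom A.pred (Vs.map GenTerm.var)))
  | .constraint => Formula.bot

/-- The completed definition of a predicate symbol. -/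
noncomputable def Program.completedDef (Pi : Program C V) (ch : Choices W Pi) (P : PredSym C) :
    Formula C V W :=
  Formula.allGs (ch.tuple P)
    (Formula.iff (Formula.atom P.1 ((ch.tuple P).map GenTerm.var))
      (Formula.disj ((Pi.definition P).toList.map fun R => R.disjunct (ch.f R) (ch.tuple P))))

/-- The natural completion of a program. -/
noncomputable def Program.ncomp (Pi : Program C V) (ch : Choices W Pi) : Set (Formula C V W) :=
  {F | (∃ P, Pi.Occurs P ∧ F = Pi.completedDef ch P) ∨
    ∃ R ∈ Pi, R.head = Head.constraint ∧
      F = Formula.closure (Formula.neg (R.bodyFormula (ch.f R)))}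

end Completion

end NatCompletion

/-! Both sides of the equivalence are reduced to the same condition on `S`: an atom belongs to `S`
exactly when it is supported (some rule instance has a body true in `S` and the atom among the
values of its head, a choice rule counting only if the atom is already in `S`), and no instance of a
constraint has a true body.

On the completion side (`Program.satisfies_ncomp`), the difficulty is that substitutions map
variables to arbitrary precomputed terms, while critical variables have become integer variables. An
assignment to both sorts yields a substitution, `inducedSubst`, under which every term of the rule
has exactly one value, so the disjunctions produced by `τ` collapse to the corresponding first-order
formulas (`BodyLit.holds_replace`). Conversely, if a substitution makes the body true and gives the
head a value, it must send critical variables to numerals (`Rule.exists_num_of_critical`), because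
arithmetic has no values elsewhere; as `f_R` is injective on those variables, the substitution is
induced by an assignment. Hence `∃ U_R F_R` expresses support (`Rule.holds_existsFormula`).

On the stable model side, being a model gives "supported implies member" and the constraints.
Minimality gives the converse: an unsupported atom could be removed from `S` without violating the
reduct (`Program.IsStableModel.supported`). Tightness is needed only to show that a supported model
is stable (`Program.Tight.isStableModel`): by induction along the acyclic dependency graph, every
atom of `S` is forced into any set satisfying the reduct. -/

namespace NatCompletion

/-! ### Semantics of two-sorted formulas: quantifier blocks and free variables -/

section Logic

variable {C V W : Type}

namespace Formula

variable (J : Interpretation C)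

theorem holds_conj (v : V → J.Gen) (w : W → J.Int) (Fs : List (Formula C V W)) :
    (conj Fs).Holds J v w ↔ ∀ F ∈ Fs, F.Holds J v w := by
  induction Fs with
  | nil => simp [conj, Holds]
  | cons F Fs ih =>
    have : conj (F :: Fs) = and F (conj Fs) := rfl
    simp [this, Holds, ih]

theorem holds_disj (v : V → J.Gen) (w : W → J.Int) (Fs : List (Formula C V W)) :
    (disj Fs).Holds J v w ↔ ∃ F ∈ Fs, F.Holds J v w := by
  induction Fs with
  | nil => simp [disj, Holds]
  | cons F Fs ih =>
    have : disj (F :: Fs) = or F (disj Fs) := rfl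
    simp [this, Holds, ih]

open Classical in
-- The list may contain repetitions: taking each quantifier's witness from the final assignment `v'`
-- makes repeated updates harmless.
theorem holds_exGs (w : W → J.Int) (Xs : List V) (F : Formula C V W) (v : V → J.Gen) :
    (exGs Xs F).Holds J v w ↔ ∃ v' : V → J.Gen, (∀ X, X ∉ Xs → v' X = v X) ∧ F.Holds J v' w := by
  induction Xs generalizing v with
  | nil =>
    constructor
    · exact fun h => ⟨v, fun _ _ => rfl, h⟩
    · rintro ⟨v', h, hF⟩
      rwa [funext fun X => h X (by simp)] at hF
  | cons Y Xs ih =>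
    have : exGs (Y :: Xs) F = exG Y (exGs Xs F) := rfl
    simp only [this, Holds, ih]
    constructor
    · rintro ⟨a, v', h, hF⟩
      refine ⟨v', fun X hX => ?_, hF⟩
      simp only [List.mem_cons, not_or] at hX
      rw [h X hX.2, Function.update_of_ne hX.1]
    · rintro ⟨v', h, hF⟩
      refine ⟨v' Y, v', fun X hX => ?_, hF⟩
      by_cases e : X = Y
      · subst e; simp
      · rw [Function.update_of_ne e]
        exact h X (by simp [e, hX])

open Classical in
theorem holds_exIs (v : V → J.Gen) (Ns : List W) (F : Formula C V W) (w : W → J.Int) :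
    (exIs Ns F).Holds J v w ↔ ∃ w' : W → J.Int, (∀ N, N ∉ Ns → w' N = w N) ∧ F.Holds J v w' := by
  induction Ns generalizing w with
  | nil =>
    constructor
    · exact fun h => ⟨w, fun _ _ => rfl, h⟩
    · rintro ⟨w', h, hF⟩
      rwa [funext fun X => h X (by simp)] at hF
  | cons Y Ns ih =>
    have : exIs (Y :: Ns) F = exI Y (exIs Ns F) := rfl
    simp only [this, Holds, ih]
    constructor
    · rintro ⟨a, w', h, hF⟩
      refine ⟨w', fun X hX => ?_, hF⟩
      simp only [List.mem_cons, not_or] at hX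
      rw [h X hX.2, Function.update_of_ne hX.1]
    · rintro ⟨w', h, hF⟩
      refine ⟨w' Y, w', fun X hX => ?_, hF⟩
      by_cases e : X = Y
      · subst e; simp
      · rw [Function.update_of_ne e]
        exact h X (by simp [e, hX])

/-- Truth under all assignments is insensitive to universal quantifiers: updating `v` at `Y` by `v
Y` changes nothing. So neither closures nor completed definitions require knowing which variables
are quantified. -/
theorem forall_holds_allGs (Xs : List V) (F : Formula C V W) (w : W → J.Int) :
    (∀ v : V → J.Gen, (allGs Xs F).Holds J v w) ↔ ∀ v : V → J.Gen, F.Holds J v w := by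
  induction Xs with
  | nil => rfl
  | cons Y Xs ih =>
    have : allGs (Y :: Xs) F = allG Y (allGs Xs F) := rfl
    simp only [this, Holds, ← ih]
    constructor
    · intro h v
      simpa using h v (v Y)
    · exact fun h v a => h _

theorem forall_holds_allIs (Ns : List W) (F : Formula C V W) (v : V → J.Gen) :
    (∀ w : W → J.Int, (allIs Ns F).Holds J v w) ↔ ∀ w : W → J.Int, F.Holds J v w := by
  induction Ns with
  | nil => rfl
  | cons Y Ns ih =>
    have : allIs (Y :: Ns) F = allI Y (allIs Ns F) := rfl
    simp only [this, Holds, ← ih]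
    constructor
    · intro h w
      simpa using h w (w Y)
    · exact fun h v a => h _

theorem forall_holds_closure (F : Formula C V W) :
    (∀ (v : V → J.Gen) (w : W → J.Int), F.closure.Holds J v w) ↔
      ∀ (v : V → J.Gen) (w : W → J.Int), F.Holds J v w := by
  rw [forall_comm]
  simp only [closure, forall_holds_allGs]
  rw [forall_comm]
  simp only [forall_holds_allIs]

end Formula

variable (J : Interpretation C)

theorem IntTerm.eval_congr {w w' : W → J.Int} (t : IntTerm W) (h : ∀ N ∈ t.ivars, w N = w' N) :
    t.eval J w = t.eval J w' := by
  induction t with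
  | num n => rfl
  | var N => exact h N (by simp [IntTerm.ivars])
  | add s t hs ht | sub s t hs ht | mul s t hs ht =>
    simp only [IntTerm.ivars, Finset.mem_union] at h
    simp only [IntTerm.eval, hs fun N hN => h N (.inl hN), ht fun N hN => h N (.inr hN)]

theorem GenTerm.eval_congr {v v' : V → J.Gen} {w w' : W → J.Int} (t : GenTerm C V W)
    (hv : ∀ X ∈ t.gvars, v X = v' X) (hw : ∀ N ∈ t.ivars, w N = w' N) :
    t.eval J v w = t.eval J v' w' := by
  cases t with
  | sym c => rfl
  | var X => exact hv X (by simp [GenTerm.gvars])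
  | int t => exact congrArg J.incl (t.eval_congr J hw)

theorem map_eval_congr {v v' : V → J.Gen} {w w' : W → J.Int} (ts : List (GenTerm C V W))
    (hv : ∀ X ∈ tupleGvars ts, v X = v' X) (hw : ∀ N ∈ tupleIvars ts, w N = w' N) :
    ts.map (GenTerm.eval J v w) = ts.map (GenTerm.eval J v' w') := by
  refine List.map_congr_left fun t ht => t.eval_congr J (fun X hX => hv X ?_) fun N hN => hw N ?_
  · simp only [tupleGvars, Finset.mem_biUnion, List.mem_toFinset]
    exact ⟨t, ht, hX⟩
  · simp only [tupleIvars, Finset.mem_biUnion, List.mem_toFinset]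
    exact ⟨t, ht, hN⟩

open Classical in
theorem Formula.holds_congr {v v' : V → J.Gen} {w w' : W → J.Int} (F : Formula C V W)
    (hv : ∀ X ∈ F.gfree, v X = v' X) (hw : ∀ N ∈ F.ifree, w N = w' N) :
    F.Holds J v w ↔ F.Holds J v' w' := by
  induction F generalizing v v' w w' with
  | atom p ts => simp only [Holds, map_eval_congr J ts hv hw]
  | eq s t | rel r s t =>
    simp only [gfree, ifree, Finset.mem_union] at hv hw
    simp only [Holds, s.eval_congr J (fun X hX => hv X (.inl hX)) fun N hN => hw N (.inl hN),
      t.eval_congr J (fun X hX => hv X (.inr hX)) fun N hN => hw N (.inr hN)]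
  | top | bot => rfl
  | neg F ih => exact not_congr (ih hv hw)
  | and F G hF hG | or F G hF hG | iff F G hF hG =>
    simp only [gfree, ifree, Finset.mem_union] at hv hw
    simp only [Holds, hF (fun X hX => hv X (.inl hX)) fun N hN => hw N (.inl hN),
      hG (fun X hX => hv X (.inr hX)) fun N hN => hw N (.inr hN)]
  | allG Y F ih | exG Y F ih =>
    have (a : J.Gen) : F.Holds J (Function.update v Y a) w ↔
        F.Holds J (Function.update v' Y a) w' := by
      refine ih (fun X hX => ?_) hw
      by_cases e : X = Y
      · subst e; simp
      · simpa [Function.update_of_ne e] using hv X (by simp [gfree, e, hX])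
    simp only [Holds, this]
  | allI Y F ih | exI Y F ih =>
    have (a : J.Int) : F.Holds J v (Function.update w Y a) ↔
        F.Holds J v' (Function.update w' Y a) := by
      refine ih hv (fun X hX => ?_)
      by_cases e : X = Y
      · subst e; simp
      · simpa [Function.update_of_ne e] using hw X (by simp [ifree, e, hX])
    simp only [Holds, this]

theorem holds_tupleEq (v : V → J.Gen) (w : W → J.Int) (ss ts : List (GenTerm C V W))
    (h : ss.length = ts.length) :
    (tupleEq ss ts).Holds J v w ↔
      ss.map (GenTerm.eval J v w) = ts.map (GenTerm.eval J v w) := by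
  unfold tupleEq
  induction ss generalizing ts with
  | nil => cases ts with
    | nil => simp [Formula.conj, Formula.Holds]
    | cons t ts => simp at h
  | cons s ss ih => cases ts with
    | nil => simp at h
    | cons t ts =>
      have e : Formula.conj (List.zipWith Formula.eq (s :: ss) (t :: ts)) =
        .and (.eq s t) (Formula.conj (List.zipWith Formula.eq ss ts)) := rfl
      rw [e]
      simp only [Formula.Holds, ih ts (by simpa using h), List.map_cons, List.cons.injEq]

end Logic

/-! ### Reducts of infinitary formulas -/

namespace InfForm

variable {A : Type}

/-- The reduct of a formula not satisfied by `I` is `⊥`. Consequently the case distinction in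
`reduct` disappears from the clauses for conjunction and disjunction, and survives only for atoms
and implications. -/
theorem sat_of_sat_reduct {I J : Set A} {F : InfForm A} (h : Sat J (reduct I F)) : Sat I F := by
  by_contra hn
  cases F with
  | bot => exact h
  | atom a => simp only [Sat] at hn; simp [reduct, hn, Sat] at h
  | conj F | disj F | imp F G =>
    rw [reduct, if_neg hn] at h
    exact h

theorem sat_reduct_atom (I J : Set A) (a : A) : Sat J (reduct I (atom a)) ↔ a ∈ I ∧ a ∈ J := by
  by_cases h : a ∈ I <;> simp [reduct, h, Sat]

theorem sat_reduct_conj (I J : Set A) {ι : Type} (F : ι → InfForm A) :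
    Sat J (reduct I (conj F)) ↔ ∀ i, Sat J (reduct I (F i)) := by
  constructor
  · intro h
    rwa [reduct, if_pos (sat_of_sat_reduct h)] at h
  · intro h
    have h' : Sat I (conj F) := fun i => sat_of_sat_reduct (h i)
    rw [reduct, if_pos h']
    exact h

theorem sat_reduct_disj (I J : Set A) {ι : Type} (F : ι → InfForm A) :
    Sat J (reduct I (disj F)) ↔ ∃ i, Sat J (reduct I (F i)) := by
  constructor
  · intro h
    rwa [reduct, if_pos (sat_of_sat_reduct h)] at h
  · intro h
    have h' : Sat I (disj F) := h.imp fun i => sat_of_sat_reduct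
    rw [reduct, if_pos h']
    exact h

theorem sat_reduct_imp (I J : Set A) (F G : InfForm A) :
    Sat J (reduct I (imp F G)) ↔ Sat I (imp F G) ∧ (Sat J (reduct I F) → Sat J (reduct I G)) := by
  constructor
  · intro h
    have h' := sat_of_sat_reduct h
    rw [reduct, if_pos h'] at h
    exact ⟨h', h⟩
  · rintro ⟨h', h⟩
    rw [reduct, if_pos h']
    exact h

/-- Negation is evaluated entirely at `I`: this is why negated body atoms play no role in the
dependency graph. -/
theorem sat_reduct_neg (I J : Set A) (F : InfForm A) :
    Sat J (reduct I (neg F)) ↔ ¬ Sat I F := by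
  rw [neg, sat_reduct_imp]
  exact ⟨fun h => h.1, fun h => ⟨h, fun h' => (h (sat_of_sat_reduct h')).elim⟩⟩

theorem sat_or (I : Set A) (F G : InfForm A) : Sat I (or F G) ↔ Sat I F ∨ Sat I G := by
  simp [or, Sat, or_comm]

theorem sat_reduct_or (I J : Set A) (F G : InfForm A) :
    Sat J (reduct I (or F G)) ↔ Sat J (reduct I F) ∨ Sat J (reduct I G) := by
  simp [or, sat_reduct_disj, or_comm]

/-- The head of a choice rule restricts `J` only at atoms that already belong to `I`. -/
theorem sat_reduct_excludedMiddle (I J : Set A) (a : A) :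
    Sat J (reduct I (or (atom a) (neg (atom a)))) ↔ (a ∈ I → a ∈ J) := by
  rw [sat_reduct_or, sat_reduct_atom, sat_reduct_neg]
  simp only [Sat]
  tauto

end InfForm

theorem sat_truthValue {C : Type} (S : Set (GroundAtom C)) (p : Prop) :
    InfForm.Sat S (truthValue p) ↔ p := by
  by_cases h : p <;> simp [truthValue, h, InfForm.Sat, InfForm.top]

theorem sat_reduct_truthValue {C : Type} (S J : Set (GroundAtom C)) (p : Prop) :
    InfForm.Sat J (InfForm.reduct S (truthValue p)) ↔ p := by
  by_cases h : p
  · simp [truthValue, h, InfForm.top, InfForm.sat_reduct_imp, InfForm.Sat]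
  · simp [truthValue, h, InfForm.Sat, InfForm.reduct]

/-! ### Values of terms and substitutions induced by two-sorted assignments -/

section Values

variable {C V W : Type}

/-- Operations produce values only from numeral operands, so a numeral value propagates down to
every variable. For a bare variable the value must be assumed to be a numeral; for variables under
an operation any value suffices, as in the next lemma. -/
theorem RegTerm.exists_num_of_mem_values {θ : V → Precomputed C} (t : RegTerm V) {n : ℤ}
    (h : Precomputed.num n ∈ t.values θ) : ∀ X ∈ t.vars, ∃ k, θ X = .num k := by
  induction t generalizing n with
  | num m => simp [RegTerm.vars]
  | var X =>
    rintro Y rfl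
    exact ⟨n, h.symm⟩
  | add s t hs ht | sub s t hs ht | mul s t hs ht =>
    obtain ⟨a, b, ha, hb, -⟩ := h
    rintro X (hX | hX)
    · exact hs ha X hX
    · exact ht hb X hX

theorem RegTerm.exists_num_of_opVars {θ : V → Precomputed C} (t : RegTerm V) {r : Precomputed C}
    (h : r ∈ t.values θ) : ∀ X ∈ t.opVars, ∃ k, θ X = .num k := by
  cases t with
  | num m => simp [RegTerm.opVars]
  | var X => simp [RegTerm.opVars]
  | add s t | sub s t | mul s t =>
    obtain ⟨a, b, ha, hb, -⟩ := h
    rintro X (hX | hX)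
    · exact s.exists_num_of_mem_values ha X hX
    · exact t.exists_num_of_mem_values hb X hX

theorem Arg.exists_num_of_opVars {θ : V → Precomputed C} (t : Arg C V) {r : Precomputed C}
    (h : r ∈ t.values θ) : ∀ X ∈ t.opVars, ∃ k, θ X = .num k := by
  cases t with
  | sym c => simp [Arg.opVars]
  | reg t => exact t.exists_num_of_opVars h

theorem RegAtom.exists_num_of_opVars {θ : V → Precomputed C} (A : RegAtom C V)
    {rs : List (Precomputed C)} (h : rs ∈ tupleValues θ A.args) :
    ∀ X ∈ A.opVars, ∃ k, θ X = .num k := by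
  rintro X ⟨t, ht, hX⟩
  have h : List.Forall₂ (fun r t => r ∈ Arg.values θ t) rs A.args := h
  obtain ⟨i, hi, rfl⟩ := List.getElem_of_mem ht
  have hmem := (List.forall₂_iff_get.1 h).2 i (by rw [h.length_eq]; exact hi) hi
  exact Arg.exists_num_of_opVars _ hmem X hX

/-- The substitution determined by an assignment of values to general and integer variables. -/
noncomputable def inducedSubst (K : Set V) (f : V → W) (v : V → Precomputed C) (w : W → ℤ) :
    V → Precomputed C :=
  open Classical in fun X => if X ∈ K then .num (w (f X)) else v X

/-- This is the only use of injectivity of `f_R`: different critical variables can receive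
independent integers. The general part of the assignment may be `θ` itself. -/
theorem exists_inducedSubst_eq (K : Set V) {f : V → W} (hf : Set.InjOn f K) (θ : V → Precomputed C)
    (hθ : ∀ X ∈ K, ∃ k, θ X = .num k) : ∃ w : W → ℤ, inducedSubst K f θ w = θ := by
  classical
  choose! g hg using hθ
  -- Invert `f` on its image of `K`; the value 0 at other integer variables is arbitrary.
  refine ⟨fun N => if h : ∃ X ∈ K, f X = N then g h.choose else 0, funext fun X => ?_⟩
  by_cases hX : X ∈ K
  · have h : ∃ Y ∈ K, f Y = f X := ⟨X, hX, rfl⟩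
    have e : h.choose = X := hf h.choose_spec.1 hX h.choose_spec.2
    simp only [inducedSubst, hX, if_true, dif_pos h, e]
    exact (hg X hX).symm
  · simp [inducedSubst, hX]

theorem Head.IsFor.unique {H : Head C V} {A B : RegAtom C V} (hA : H.IsFor A) (hB : H.IsFor B) :
    A = B := by
  rcases hA with rfl | rfl <;> rcases hB with h | h <;> cases h <;> rfl

theorem exists_assignment (Xs : List V) (h : Xs.Nodup) (rs : List (Precomputed C))
    (hlen : rs.length = Xs.length) : ∃ v : V → Precomputed C, Xs.map v = rs := by
  classical
  induction Xs generalizing rs with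
  | nil => exact ⟨fun _ => .num 0, by simpa [eq_comm] using hlen⟩
  | cons X Xs ih =>
    cases rs with
    | nil => simp at hlen
    | cons r rs =>
      obtain ⟨hX, hXs⟩ := List.nodup_cons.1 h
      obtain ⟨v, hv⟩ := ih hXs rs (by simpa using hlen)
      refine ⟨Function.update v X r, ?_⟩
      rw [List.map_cons, Function.update_self, ← hv]
      congr 1
      exact List.map_congr_left fun Y hY =>
        Function.update_of_ne (ne_of_mem_of_not_mem hY hX) _ _

theorem RegAtom.length_eq_of_mem_tupleValues {θ : V → Precomputed C} {ts : List (Arg C V)}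
    {rs : List (Precomputed C)} (h : rs ∈ tupleValues θ ts) : rs.length = ts.length :=
  List.Forall₂.length_eq h

variable [LinearOrder (Precomputed C)]

theorem BodyLit.exists_num_of_critical {θ : V → Precomputed C} {S : Set (GroundAtom C)}
    (B : BodyLit C V) (h : InfForm.Sat S (B.tau θ)) :
    ∀ X ∈ B.critical, ∃ k, θ X = .num k := by
  cases B with
  | pos A | neg A =>
    obtain ⟨⟨rs, hrs⟩, -⟩ := h
    exact A.exists_num_of_opVars hrs
  | eq s t | rel c s t =>
    obtain ⟨a, ha, b, hb, -⟩ := (sat_truthValue _ _).1 h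
    rintro X (hX | hX)
    · exact s.exists_num_of_opVars ha X hX
    · exact t.exists_num_of_opVars hb X hX
  | interval t₁ t₂ t₃ =>
    obtain ⟨a, ha, b, ⟨m, n, k, hm, hn, -, -, rfl⟩, rfl⟩ := (sat_truthValue _ _).1 h
    rintro X ((hX | hX) | hX)
    · exact t₁.exists_num_of_mem_values ha X hX
    · exact t₂.exists_num_of_mem_values hm X hX
    · exact t₃.exists_num_of_mem_values hn X hX

variable (S : Set (GroundAtom C)) (K : Set V) (f : V → W) (v : V → Precomputed C) (w : W → ℤ)

/-- All variables of `t` stand for numerals, so every operation is defined and the set of values is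
a singleton. -/
theorem RegTerm.values_inducedSubst (t : RegTerm V) (h : t.vars ⊆ K) :
    t.values (inducedSubst K f v w) = {.num ((t.toInt f).eval (up S) w)} := by
  induction t with
  | num n => rfl
  | var X =>
    have : X ∈ K := h rfl
    simp [RegTerm.values, inducedSubst, this, RegTerm.toInt, IntTerm.eval]
  | add s t hs ht | sub s t hs ht | mul s t hs ht =>
    have h1 := hs fun X hX => h (.inl hX)
    have h2 := ht fun X hX => h (.inr hX)
    ext r
    simp only [RegTerm.values, h1, h2]
    constructor
    · rintro ⟨m, n, hm, hn, rfl⟩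
      cases hm
      cases hn
      rfl
    · rintro rfl
      exact ⟨_, _, rfl, rfl, rfl⟩

theorem Arg.values_inducedSubst (t : Arg C V) (h : t.opVars ⊆ K) :
    t.values (inducedSubst K f v w) = {(t.replace K f).eval (up S) v w} := by
  cases t with
  | sym c => rfl
  | reg t =>
    cases t with
    | num n => rfl
    | var X =>
      by_cases hX : X ∈ K <;>
        simp [Arg.values, RegTerm.values, Arg.replace, inducedSubst, hX, GenTerm.eval,
          IntTerm.eval, up]
    | add s t | sub s t | mul s t =>
      exact RegTerm.values_inducedSubst S K f v w _ h

theorem tupleValues_inducedSubst (ts : List (Arg C V)) (h : ∀ t ∈ ts, t.opVars ⊆ K) :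
    tupleValues (inducedSubst K f v w) ts =
      {(replaceTuple K f ts).map (GenTerm.eval (up S) v w)} := by
  ext rs
  change List.Forall₂ _ rs ts ↔ rs = _
  simp only [replaceTuple, List.map_map]
  induction ts generalizing rs with
  | nil => exact List.forall₂_nil_right_iff
  | cons t ts ih =>
    rw [List.forall₂_cons_right_iff]
    have h1 := Arg.values_inducedSubst S K f v w t (h t (by simp))
    have h2 := fun rs => ih (fun t ht => h t (by simp [ht])) rs
    simp only [h1, h2]
    constructor
    · rintro ⟨r, rs, hr, rfl, rfl⟩
      cases hr
      rfl
    · rintro rfl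
      exact ⟨_, _, rfl, rfl, rfl⟩

theorem StandardOrder.num_le_num (hord : StandardOrder C) (m n : ℤ) :
    (Precomputed.num m : Precomputed C) ≤ Precomputed.num n ↔ m ≤ n := by
  rw [← not_lt, hord.num_lt_num, not_lt]

/-- Value sets of the arguments are singletons, so each disjunction in `τ` has one member and each
comparison one pair to compare. For intervals, `hord` turns the order on numerals into the order on
integers. -/
theorem BodyLit.holds_replace (hord : StandardOrder C) (B : BodyLit C V) (h : B.critical ⊆ K) :
    (B.replace K f).Holds (up S) v w ↔ InfForm.Sat S (B.tau (inducedSubst K f v w)) := by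
  cases B with
  | pos A | neg A =>
    have := tupleValues_inducedSubst S K f v w A.args fun t ht X hX => h ⟨t, ht, hX⟩
    simp only [BodyLit.replace, BodyLit.tau, Formula.Holds, InfForm.Sat, InfForm.neg]
    constructor
    · exact fun hS => ⟨⟨_, this ▸ rfl⟩, hS⟩
    · rintro ⟨⟨rs, hrs⟩, hS⟩
      rw [this] at hrs
      cases hrs
      exact hS
  | eq s t | rel c s t =>
    have h1 := Arg.values_inducedSubst S K f v w s fun X hX => h (.inl hX)
    have h2 := Arg.values_inducedSubst S K f v w t fun X hX => h (.inr hX)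
    simp only [BodyLit.tau, sat_truthValue, h1, h2]
    simp [BodyLit.replace, Formula.Holds, up]
  | interval t₁ t₂ t₃ =>
    have h1 := RegTerm.values_inducedSubst S K f v w t₁ fun X hX => h (.inl (.inl hX))
    have h2 := RegTerm.values_inducedSubst S K f v w t₂ fun X hX => h (.inl (.inr hX))
    have h3 := RegTerm.values_inducedSubst S K f v w t₃ fun X hX => h (.inr hX)
    simp only [BodyLit.tau, sat_truthValue, h1, h2, h3, intervalValues, BodyLit.replace]
    change (Precomputed.num _ : Precomputed C) ≤ .num _ ∧
      (Precomputed.num _ : Precomputed C) ≤ .num _ ↔ _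
    refine (and_congr (hord.num_le_num _ _) (hord.num_le_num _ _)).trans ?_
    constructor
    · rintro ⟨ha, hb⟩
      exact ⟨_, rfl, _, ⟨_, _, _, rfl, rfl, ha, hb, rfl⟩, rfl⟩
    · rintro ⟨_, rfl, _, ⟨m, n, k, hm, hn, ha, hb, rfl⟩, he⟩
      cases hm
      cases hn
      cases he
      exact ⟨ha, hb⟩

theorem Rule.holds_bodyFormula (hord : StandardOrder C) (R : Rule C V) :
    (R.bodyFormula f).Holds (up S) v w ↔
      InfForm.Sat S (R.tauBody (inducedSubst R.critical f v w)) := by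
  refine (Formula.holds_conj (up S) v w _).trans ?_
  simp only [List.forall_mem_map, Rule.tauBody, InfForm.Sat, Subtype.forall]
  exact forall₂_congr fun B hB =>
    B.holds_replace S R.critical f v w hord fun X hX => .inr ⟨B, hB, hX⟩

end Values

/-! ### Translated rules introduce no new general variables -/

section FreeVariables

variable {C V W : Type} (K : Set V) (f : V → W)

theorem Arg.gvars_replace (t : Arg C V) : ∀ X ∈ (t.replace K f).gvars, X ∈ t.vars := by
  intro X hX
  cases t with
  | sym c => simp [Arg.replace, GenTerm.gvars] at hX
  | reg t =>
    cases t with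
    | var Y =>
      by_cases hY : Y ∈ K
      · simp [Arg.replace, hY, GenTerm.gvars] at hX
      · simpa [Arg.replace, hY, GenTerm.gvars, Arg.vars, RegTerm.vars] using hX
    | num | add | sub | mul => simp [Arg.replace, GenTerm.gvars] at hX

theorem tupleGvars_replaceTuple (ts : List (Arg C V)) :
    ∀ X ∈ tupleGvars (replaceTuple K f ts), ∃ t ∈ ts, X ∈ t.vars := by
  intro X hX
  simp only [tupleGvars, replaceTuple, Finset.mem_biUnion, List.mem_toFinset, List.mem_map] at hX
  obtain ⟨_, ⟨t, ht, rfl⟩, hX⟩ := hX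
  exact ⟨t, ht, t.gvars_replace K f X hX⟩

theorem BodyLit.gfree_replace (B : BodyLit C V) : ∀ X ∈ (B.replace K f).gfree, X ∈ B.vars := by
  intro X hX
  cases B with
  | pos A | neg A => exact tupleGvars_replaceTuple K f A.args X hX
  | eq s t | rel c s t =>
    simp only [BodyLit.replace, Formula.gfree, Finset.mem_union] at hX
    exact hX.imp (s.gvars_replace K f X) (t.gvars_replace K f X)
  | interval => simp [BodyLit.replace, Formula.gfree, GenTerm.gvars] at hX

theorem Formula.gfree_conj (Fs : List (Formula C V W)) :
    ∀ X ∈ (Formula.conj Fs).gfree, ∃ F ∈ Fs, X ∈ F.gfree := by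
  intro X hX
  induction Fs with
  | nil => simp [Formula.conj, Formula.gfree] at hX
  | cons F Fs ih =>
    have : conj (F :: Fs) = and F (conj Fs) := rfl
    simp only [this, Formula.gfree, Finset.mem_union] at hX
    rcases hX with hX | hX
    · exact ⟨F, by simp, hX⟩
    · obtain ⟨G, hG, hX⟩ := ih hX
      exact ⟨G, by simp [hG], hX⟩

theorem Rule.gfree_bodyFormula (R : Rule C V) : ∀ X ∈ (R.bodyFormula f).gfree, X ∈ R.vars := by
  intro X hX
  obtain ⟨F, hF, hX⟩ := Formula.gfree_conj _ X hX
  obtain ⟨B, hB, rfl⟩ := List.mem_map.1 hF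
  exact .inr ⟨B, hB, B.gfree_replace _ f X hX⟩

end FreeVariables

/-! ### The natural completion expresses support -/

section Completion

variable {C V W : Type} [LinearOrder (Precomputed C)]

/-- A rule with the head `A` or `{A}` supports the atom with the arguments `rs` relative to `S`. -/
def Rule.Supports (S : Set (GroundAtom C)) (R : Rule C V) (A : RegAtom C V)
    (rs : List (Precomputed C)) : Prop :=
  ∃ θ : V → Precomputed C, InfForm.Sat S (R.tauBody θ) ∧ rs ∈ tupleValues θ A.args

/-- Instances that send a critical variable to a symbolic constant have a false body or a head
without values, so restricting critical variables to integers loses nothing. For constraints the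
condition on the head is vacuous. -/
theorem Rule.exists_num_of_critical {S : Set (GroundAtom C)} {θ : V → Precomputed C}
    (R : Rule C V) (hbody : InfForm.Sat S (R.tauBody θ))
    (hhead : ∀ A, R.head.IsFor A → (tupleValues θ A.args).Nonempty) :
    ∀ X ∈ R.critical, ∃ k, θ X = .num k := by
  rintro X (⟨A, hA, hX⟩ | ⟨B, hB, hX⟩)
  · obtain ⟨rs, hrs⟩ := hhead A hA
    exact A.exists_num_of_opVars hrs X hX
  · exact B.exists_num_of_critical (hbody ⟨B, hB⟩) X hX

/-- Assignments and substitutions are converted into each other by `inducedSubst`. The conditions on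
`extra` keep its free variables among `Vs`, out of reach of the quantifiers. -/
theorem Rule.holds_existsFormula (hord : StandardOrder C) (S : Set (GroundAtom C)) (R : Rule C V)
    {f : V → W} (hf : Set.InjOn f R.critical) (Vs : List V) (hVs : ∀ X ∈ Vs, X ∉ R.vars)
    (A : RegAtom C V) (hA : R.head.IsFor A) (hlen : Vs.length = A.args.length)
    (extra : Option (Formula C V W))
    (hgextra : ∀ G ∈ extra, ∀ X ∈ G.gfree, X ∈ Vs) (hiextra : ∀ G ∈ extra, G.ifree = ∅)
    (v : V → Precomputed C) (w : W → ℤ) :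
    (R.existsFormula f Vs A extra).Holds (up S) v w ↔
      R.Supports S A (Vs.map v) ∧ ∀ G ∈ extra, G.Holds (up S) v w := by
  classical
  set ts := replaceTuple R.critical f A.args with hts
  set L := (R.bodyFormula f).gfree ∪ tupleGvars ts with hL
  set M := (R.bodyFormula f).ifree ∪ tupleIvars ts with hM
  have hLvars : ∀ X ∈ L, X ∈ R.vars := by
    intro X hX
    rcases Finset.mem_union.1 hX with hX | hX
    · exact R.gfree_bodyFormula f X hX
    · exact .inl ⟨A, hA, tupleGvars_replaceTuple _ f _ X hX⟩
  have hVL : ∀ X ∈ Vs, X ∉ L := fun X hX hXL => hVs X hX (hLvars X hXL)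
  have hcrit : ∀ t ∈ A.args, t.opVars ⊆ R.critical := fun t ht X hX => .inl ⟨A, hA, t, ht, hX⟩
  have hlen' : (Vs.map (GenTerm.var : V → GenTerm C V W)).length = ts.length := by
    simp [hts, replaceTuple, hlen]
  -- Since `Vs` is disjoint from the quantified variables `L`, the tuple `Vs` and the conjunct
  -- `extra` may be evaluated at the original assignment.
  have key : ∀ (v' : V → Precomputed C) (w' : W → ℤ), (∀ X ∉ L, v' X = v X) →
      ((match (generalizing := false) extra with
        | none => Formula.and (R.bodyFormula f) (tupleEq (Vs.map GenTerm.var) ts)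
        | some G => Formula.and (Formula.and (R.bodyFormula f)
            (tupleEq (Vs.map GenTerm.var) ts)) G : Formula C V W).Holds (up S) v' w' ↔
        ((R.bodyFormula f).Holds (up S) v' w' ∧
          Vs.map v = ts.map (GenTerm.eval (up S) v' w')) ∧
          ∀ G ∈ extra, G.Holds (up S) v w) := by
    intro v' w' hv'
    have e : (Vs.map (GenTerm.var : V → GenTerm C V W)).map (GenTerm.eval (up S) v' w') =
        Vs.map v := by
      rw [List.map_map]
      exact List.map_congr_left fun X hX => hv' X (hVL X hX)
    have e' := holds_tupleEq (up S) v' w' _ _ hlen'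
    rw [e] at e'
    cases extra with
    | none =>
      exact ⟨fun h => ⟨⟨h.1, e'.1 h.2⟩, nofun⟩, fun h => ⟨h.1.1, e'.2 h.1.2⟩⟩
    | some G =>
      have : G.Holds (up S) v' w' ↔ G.Holds (up S) v w :=
        G.holds_congr (up S) (fun X hX => hv' X (hVL X (hgextra G rfl X hX)))
          fun N hN => by simp [hiextra G rfl] at hN
      refine ⟨fun h => ⟨⟨h.1.1, e'.1 h.1.2⟩, ?_⟩,
        fun h => ⟨⟨h.1.1, e'.2 h.1.2⟩, this.2 (h.2 G rfl)⟩⟩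
      rintro _ ⟨⟩
      exact this.1 h.2
  refine (Formula.holds_exGs (up S) w L.toList _ v).trans ?_
  simp only [Finset.mem_toList]
  constructor
  · rintro ⟨v', hv', h⟩
    obtain ⟨w', -, h⟩ := (Formula.holds_exIs (up S) v' M.toList _ w).1 h
    obtain ⟨⟨hb, ht⟩, hG⟩ := (key v' w' hv').1 h
    refine ⟨⟨inducedSubst R.critical f v' w', (R.holds_bodyFormula S f v' w' hord).1 hb, ?_⟩, hG⟩
    rw [tupleValues_inducedSubst S R.critical f v' w' _ hcrit]
    exact ht
  · rintro ⟨⟨θ, hb, ht⟩, hG⟩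
    obtain ⟨g, hg⟩ := exists_inducedSubst_eq R.critical hf θ
      (R.exists_num_of_critical hb fun B hB => ⟨_, hA.unique hB ▸ ht⟩)
    have hb' := (R.holds_bodyFormula S f θ g hord).2 (hg.symm ▸ hb)
    have ht' : Vs.map v ∈ tupleValues (inducedSubst R.critical f θ g) A.args := hg.symm ▸ ht
    rw [tupleValues_inducedSubst S R.critical f θ g _ hcrit] at ht'
    -- The pair `θ`, `g` may differ from `v`, `w` at variables that are not quantified, so it is
    -- used only on `L` and `M`; these contain all the free variables of the body and the head
    -- tuple.
    let v' : V → Precomputed C := fun X => if X ∈ L then θ X else v X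
    let w' : W → ℤ := fun N => if N ∈ M then g N else w N
    have hvL : ∀ X ∈ L, v' X = θ X := fun X hX => if_pos hX
    have hwM : ∀ N ∈ M, w' N = g N := fun N hN => if_pos hN
    have hv' : ∀ X ∉ L, v' X = v X := fun X hX => if_neg hX
    refine ⟨v', hv', (Formula.holds_exIs (up S) v' M.toList _ w).2
      ⟨w', fun N hN => if_neg fun h => hN (Finset.mem_toList.2 h),
        (key v' w' hv').2 ⟨⟨?_, ?_⟩, hG⟩⟩⟩
    · refine (Formula.holds_congr (up S) _ (fun X hX => hvL X ?_) fun N hN => hwM N ?_).2 hb'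
      · exact Finset.mem_union_left _ hX
      · exact Finset.mem_union_left _ hN
    · refine ht'.trans (map_eval_congr (up S) _ (fun X hX => (hvL X ?_).symm)
        fun N hN => (hwM N ?_).symm)
      · exact Finset.mem_union_right _ hX
      · exact Finset.mem_union_right _ hN

theorem Rule.holds_disjunct (hord : StandardOrder C) (S : Set (GroundAtom C)) (R : Rule C V)
    {f : V → W} (hf : Set.InjOn f R.critical) (Vs : List V) (hVs : ∀ X ∈ Vs, X ∉ R.vars)
    (A : RegAtom C V) (hA : R.head.IsFor A) (hlen : Vs.length = A.args.length)
    (v : V → Precomputed C) (w : W → ℤ) :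
    (R.disjunct f Vs).Holds (up S) v w ↔ R.Supports S A (Vs.map v) ∧
      (R.head = Head.choice A → (⟨A.pred, Vs.map v⟩ : GroundAtom C) ∈ S) := by
  rcases hA with h | h
  · have e : R.disjunct f Vs = R.existsFormula f Vs A none := by rw [Rule.disjunct, h]
    rw [e, R.holds_existsFormula hord S hf Vs hVs A (.inl h) hlen] <;> simp [h]
  · have e : R.disjunct f Vs =
        R.existsFormula f Vs A (some (Formula.atom A.pred (Vs.map GenTerm.var))) := by
      rw [Rule.disjunct, h]
    rw [e, R.holds_existsFormula hord S hf Vs hVs A (.inr h) hlen]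
    · simp [h, Formula.Holds, up, GenTerm.eval, Function.comp_def]
    · simp [Formula.gfree, tupleGvars, GenTerm.gvars]
    · simp [Formula.ifree, tupleIvars, GenTerm.ivars, Finset.ext_iff]

/-- An atom is supported in a program relative to `S`. -/
def Program.Supported (Pi : Program C V) (S : Set (GroundAtom C)) (a : GroundAtom C) : Prop :=
  ∃ R ∈ Pi, ∃ A, R.head.IsFor A ∧ A.pred = a.pred ∧ R.Supports S A a.args ∧
    (R.head = Head.choice A → a ∈ S)

/-- The variables in the chosen tuple are distinct, so its values range over all tuples of the right
length. -/
theorem Program.holds_completedDef (hord : StandardOrder C) (Pi : Program C V)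
    (ch : Choices W Pi) (S : Set (GroundAtom C)) (P : PredSym C) (hP : Pi.Occurs P) :
    (∀ (v : V → (up S).Gen) (w : W → (up S).Int), (Pi.completedDef ch P).Holds (up S) v w) ↔
      ∀ rs : List (Precomputed C), rs.length = P.2 →
        ((⟨P.1, rs⟩ : GroundAtom C) ∈ S ↔ Pi.Supported S ⟨P.1, rs⟩) := by
  have key : ∀ (v : V → Precomputed C) (w : W → ℤ),
      (Formula.iff (Formula.atom P.1 ((ch.tuple P).map GenTerm.var))
        (Formula.disj ((Pi.definition P).toList.map fun R =>
          R.disjunct (ch.f R) (ch.tuple P)))).Holds (up S) v w ↔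
      ((⟨P.1, (ch.tuple P).map v⟩ : GroundAtom C) ∈ S ↔
        Pi.Supported S ⟨P.1, (ch.tuple P).map v⟩) := by
    intro v w
    refine iff_congr (by simp [Formula.Holds, up, GenTerm.eval, Function.comp_def])
      ((Formula.holds_disj (up S) v w _).trans ?_)
    simp only [List.mem_map, Finset.mem_toList, Program.definition, Finset.mem_filter]
    constructor
    · rintro ⟨_, ⟨R, ⟨hR, A, hA, rfl⟩, rfl⟩, h⟩
      have h' := (R.holds_disjunct hord S (ch.f_injOn R hR) _
        (fun X hX => ch.fresh_tuple _ hP X hX R hR) A hA (ch.length_tuple _ hP) v w).1 h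
      exact ⟨R, hR, A, hA, rfl, h'⟩
    · rintro ⟨R, hR, A, hA, hpred, hs, hc⟩
      -- `Supported` fixes only the symbol of the head; the arity follows because value tuples have
      -- the length of the argument tuple.
      have hlen : A.args.length = P.2 := by
        obtain ⟨θ, -, ht⟩ := hs
        rw [← RegAtom.length_eq_of_mem_tupleValues ht, List.length_map, ch.length_tuple _ hP]
      refine ⟨_, ⟨R, ⟨hR, A, hA, Prod.ext hpred hlen⟩, rfl⟩, ?_⟩
      refine (R.holds_disjunct hord S (ch.f_injOn R hR) _
        (fun X hX => ch.fresh_tuple _ hP X hX R hR) A hA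
        ((ch.length_tuple _ hP).trans hlen.symm) v w).2 ⟨hs, fun h => ?_⟩
      have hpred : A.pred = P.1 := hpred
      rw [hpred]
      exact hc h
  rw [forall_comm]
  simp only [Program.completedDef, Formula.forall_holds_allGs]
  constructor
  · intro h rs hrs
    obtain ⟨v, rfl⟩ := exists_assignment _ (ch.nodup_tuple P hP) rs
      (hrs.trans (ch.length_tuple P hP).symm)
    exact (key v fun _ => (0 : ℤ)).1 (h _ v)
  · intro h w v
    exact (key v w).2 (h _ ((List.length_map _).trans (ch.length_tuple P hP)))

theorem Program.satisfies_ncomp (hord : StandardOrder C) (Pi : Program C V)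
    (ch : Choices W Pi) (S : Set (GroundAtom C)) (hS : S ⊆ Pi.herbrandBase) :
    (up S).Satisfies (Pi.ncomp ch) ↔ (∀ a, a ∈ S ↔ Pi.Supported S a) ∧
      ∀ R ∈ Pi, R.head = Head.constraint → ∀ θ : V → Precomputed C,
        ¬ InfForm.Sat S (R.tauBody θ) := by
  constructor
  · intro h
    refine ⟨fun a => ?_, fun R hR hc θ hb => ?_⟩
    · have hdef (hP : Pi.Occurs (a.pred, a.args.length)) : a ∈ S ↔ Pi.Supported S a :=
        (Pi.holds_completedDef hord ch S _ hP).1 (h _ (.inl ⟨_, hP, rfl⟩)) a.args rfl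
      -- Atoms without a completed definition cause no trouble: they are not in `S` by `hS`, and
      -- they are not supported because the head of a supporting rule occurs in the program.
      refine ⟨fun ha => (hdef (hS ha)).1 ha, fun ha => (hdef ?_).2 ha⟩
      obtain ⟨R, hR, A, hA, hpred, ⟨θ, -, ht⟩, -⟩ := ha
      exact ⟨R, hR, A, .inl hA,
        Prod.ext hpred (RegAtom.length_eq_of_mem_tupleValues ht).symm⟩
    · obtain ⟨g, hg⟩ := exists_inducedSubst_eq R.critical (ch.f_injOn R hR) θ
        (R.exists_num_of_critical hb fun A hA => by
          rcases hA with hA | hA <;> rw [hc] at hA <;> cases hA)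
      have := (Formula.forall_holds_closure (up S) _).1 (h _ (.inr ⟨R, hR, hc, rfl⟩)) θ g
      exact this ((R.holds_bodyFormula S _ θ g hord).2 (hg.symm ▸ hb))
  · rintro ⟨hsupp, hcon⟩ F (⟨P, hP, rfl⟩ | ⟨R, hR, hc, rfl⟩)
    · exact (Pi.holds_completedDef hord ch S P hP).2 fun rs _ => hsupp _
    · refine (Formula.forall_holds_closure (up S) _).2 fun v w h => ?_
      exact hcon R hR hc _ ((R.holds_bodyFormula S _ v w hord).1 h)

end Completion

/-! ### Stable models, supported models and tightness -/

section StableModels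

variable {C V : Type}

theorem Program.finite_occurs (Pi : Program C V) : {P | Pi.Occurs P}.Finite := by
  have h : {P | Pi.Occurs P} = ⋃ R ∈ (Pi : Set (Rule C V)),
      Set.image RegAtom.predSym {A | R.HasAtom A} := by
    ext P
    simp [Program.Occurs]
  rw [h]
  refine Pi.finite_toSet.biUnion fun R _ => Set.Finite.image _ ?_
  have hhead : {A | R.head.IsFor A}.Finite := by
    refine Set.Subsingleton.finite fun A hA B hB => ?_
    rcases hA with hA | hA <;> rcases hB with hB | hB <;> rw [hA] at hB <;> cases hB <;> rfl
  have hpos : {A | BodyLit.pos A ∈ R.body}.Finite :=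
    R.body.finite_toSet.preimage (f := BodyLit.pos) fun A _ B _ h => BodyLit.pos.inj h
  have hneg : {A | BodyLit.neg A ∈ R.body}.Finite :=
    R.body.finite_toSet.preimage (f := BodyLit.neg) fun A _ B _ h => BodyLit.neg.inj h
  exact hhead.union (hpos.union hneg)

/-- Acyclicity makes reachability a strict order, and a strict order is well-founded on a finite
set. The smaller symbol is the one reached, so induction proceeds from body predicates to head
predicates. -/
theorem Program.Tight.wellFoundedOn {Pi : Program C V} (h : Pi.Tight) :
    {P | Pi.Occurs P}.WellFoundedOn fun Q P => Relation.TransGen Pi.DepEdge P Q := by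
  have : IsStrictOrder (PredSym C) fun Q P => Relation.TransGen Pi.DepEdge P Q :=
    { irrefl := h
      trans := fun _ _ _ h₁ h₂ => h₂.trans h₁ }
  exact Pi.finite_occurs.wellFoundedOn

variable [LinearOrder (Precomputed C)]

/-- Comparisons and negated atoms have reducts that do not depend on `J`, so `J` has to agree with
`S` only on the predicate symbol of a positive atom. -/
theorem BodyLit.sat_reduct_tau {S J : Set (GroundAtom C)} {θ : V → Precomputed C}
    (B : BodyLit C V) (h : InfForm.Sat S (B.tau θ))
    (hJ : ∀ A, B = .pos A → ∀ rs, rs.length = A.args.length →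
      (⟨A.pred, rs⟩ : GroundAtom C) ∈ S → (⟨A.pred, rs⟩ : GroundAtom C) ∈ J) :
    InfForm.Sat J (InfForm.reduct S (B.tau θ)) := by
  cases B with
  | pos A =>
    obtain ⟨rs, hrs⟩ := h
    exact (InfForm.sat_reduct_disj _ _ _).2 ⟨rs, (InfForm.sat_reduct_atom _ _ _).2
      ⟨hrs, hJ A rfl _ (RegAtom.length_eq_of_mem_tupleValues rs.2) hrs⟩⟩
  | neg A =>
    obtain ⟨rs, hrs⟩ := h
    exact (InfForm.sat_reduct_disj _ _ _).2 ⟨rs, (InfForm.sat_reduct_neg _ _ _).2 hrs⟩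
  | eq | rel | interval =>
    exact (sat_reduct_truthValue _ _ _).2 ((sat_truthValue _ _).1 h)

/-- A set `J` satisfies the reduct of an instance of a rule iff `S` satisfies that instance and `J`
contains the head atoms from `S` whenever it satisfies the reduct of the body. -/
theorem Rule.sat_reduct_tau_iff (S J : Set (GroundAtom C)) (θ : V → Precomputed C)
    (R : Rule C V) :
    InfForm.Sat J (InfForm.reduct S (R.tau θ)) ↔
      (InfForm.Sat S (R.tauBody θ) → R.head ≠ .constraint ∧ ∀ A, R.head = .basic A →
        ∀ rs ∈ tupleValues θ A.args, (⟨A.pred, rs⟩ : GroundAtom C) ∈ S) ∧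
      (InfForm.Sat J (InfForm.reduct S (R.tauBody θ)) → ∀ A, R.head.IsFor A →
        ∀ rs ∈ tupleValues θ A.args, (⟨A.pred, rs⟩ : GroundAtom C) ∈ S →
          (⟨A.pred, rs⟩ : GroundAtom C) ∈ J) := by
  rcases hh : R.head with A | A | _
  · simp only [Rule.tau, hh, InfForm.sat_reduct_imp, InfForm.sat_reduct_conj,
      InfForm.sat_reduct_atom, InfForm.Sat, Subtype.forall, Head.IsFor]
    constructor
    · rintro ⟨h₁, h₂⟩
      refine ⟨fun hb => ⟨nofun, ?_⟩, fun hb => ?_⟩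
      · rintro _ ⟨⟩
        exact h₁ hb
      · rintro _ (⟨⟨⟩⟩ | ⟨⟨⟩⟩) rs hrs -
        exact (h₂ hb rs hrs).2
    · rintro ⟨h₁, h₂⟩
      refine ⟨fun hb => (h₁ hb).2 A rfl, fun hb rs hrs => ?_⟩
      have := (h₁ (InfForm.sat_of_sat_reduct hb)).2 A rfl rs hrs
      exact ⟨this, h₂ hb A (.inl rfl) rs hrs this⟩
  · simp only [Rule.tau, hh, InfForm.sat_reduct_imp, InfForm.sat_reduct_conj,
      InfForm.sat_reduct_excludedMiddle, InfForm.Sat, InfForm.sat_or, Subtype.forall, Head.IsFor]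
    constructor
    · rintro ⟨-, h₂⟩
      refine ⟨fun _ => ⟨nofun, nofun⟩, fun hb => ?_⟩
      rintro _ (⟨⟨⟩⟩ | ⟨⟨⟩⟩)
      exact h₂ hb
    · rintro ⟨-, h₂⟩
      exact ⟨fun _ rs _ => (em _).imp_right id, fun hb => h₂ hb A (.inr rfl)⟩
  · simp only [Rule.tau, hh, InfForm.sat_reduct_neg, Head.IsFor]
    constructor
    · refine fun h => ⟨fun hb => (h hb).elim, fun _ _ => ?_⟩
      rintro (⟨⟨⟩⟩ | ⟨⟨⟩⟩)
    · exact fun h hb => (h.1 hb).1 rfl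

/-- For `J = S` the condition on `J` in `Rule.sat_reduct_tau_iff` is trivial. -/
theorem Program.sat_tau_iff (Pi : Program C V) (S : Set (GroundAtom C)) :
    (∀ F ∈ Pi.tau, InfForm.Sat S (InfForm.reduct S F)) ↔
      ∀ R ∈ Pi, ∀ θ : V → Precomputed C, InfForm.Sat S (R.tauBody θ) →
        R.head ≠ .constraint ∧ ∀ A, R.head = .basic A →
          ∀ rs ∈ tupleValues θ A.args, (⟨A.pred, rs⟩ : GroundAtom C) ∈ S := by
  constructor
  · exact fun h R hR θ => ((R.sat_reduct_tau_iff S S θ).1 (h _ ⟨R, hR, θ, rfl⟩)).1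
  · rintro h _ ⟨R, hR, θ, rfl⟩
    exact (R.sat_reduct_tau_iff S S θ).2 ⟨h R hR θ, fun _ _ _ _ _ => id⟩

theorem Program.IsStableModel.supported {Pi : Program C V} {S : Set (GroundAtom C)}
    (h : Pi.IsStableModel S) {a : GroundAtom C} (ha : a ∈ S) : Pi.Supported S a := by
  by_contra hn
  have hmodel := (Pi.sat_tau_iff S).1 h.1
  -- If `S \ {a}` satisfied the reduct, minimality would put `a` into it. The reduct can fail only
  -- through a rule instance with `a` in its head and a body true in `S`, which would support `a`.
  refine (h.2 (y := S \ {a}) ?_ Set.sdiff_subset ha).2 rfl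
  rintro _ ⟨R, hR, θ, rfl⟩
  refine (R.sat_reduct_tau_iff S _ θ).2 ⟨hmodel R hR θ, fun hb A hA rs hrs hS => ⟨hS, ?_⟩⟩
  rintro rfl
  exact hn ⟨R, hR, A, hA, rfl, ⟨θ, InfForm.sat_of_sat_reduct hb, hrs⟩, fun _ => ha⟩

/-- Every model of a tight program all of whose elements are supported is stable. -/
theorem Program.Tight.isStableModel {Pi : Program C V} (hPi : Pi.Tight) {S : Set (GroundAtom C)}
    (hS : S ⊆ Pi.herbrandBase) (hmodel : ∀ F ∈ Pi.tau, InfForm.Sat S (InfForm.reduct S F))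
    (hsupp : ∀ a ∈ S, Pi.Supported S a) : Pi.IsStableModel S := by
  refine ⟨hmodel, fun J hJ _ => ?_⟩
  -- The induction is on the predicate symbol of `a`. A supporting instance has a body true in `S`;
  -- its positive atoms have strictly smaller symbols, so those in `S` lie in `J`, the reduct of the
  -- body holds in `J`, and the rule puts `a` into `J`.
  have key : ∀ P, Pi.Occurs P → ∀ a ∈ S, (a.pred, a.args.length) = P → a ∈ J := by
    intro P hP
    refine hPi.wellFoundedOn.induction (P := fun P => ∀ a ∈ S, (a.pred, a.args.length) = P → a ∈ J)
      hP fun P hP ih => ?_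
    rintro a ha rfl
    obtain ⟨R, hR, A, hA, hpred, ⟨θ, hb, ht⟩, -⟩ := hsupp a ha
    obtain ⟨p, rs⟩ := a
    cases hpred
    refine ((R.sat_reduct_tau_iff S J θ).1 (hJ _ ⟨R, hR, θ, rfl⟩)).2 ?_ A hA rs ht ha
    refine (InfForm.sat_reduct_conj _ _ _).2 fun ⟨B, hB⟩ => B.sat_reduct_tau (hb ⟨B, hB⟩) ?_
    rintro D rfl qs hqs hq
    refine ih (D.pred, qs.length) (hS hq) (.single ⟨R, hR, ⟨A, hA, ?_⟩, D, hB, ?_⟩) _ hq rfl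
    · exact Prod.ext rfl (RegAtom.length_eq_of_mem_tupleValues ht).symm
    · exact Prod.ext rfl hqs.symm
  exact fun a ha => key _ (hS ha) a ha rfl

end StableModels

end NatCompletion

/-- `C`, `V`, `W` are the sets of symbolic constants, general variables, integer variables. -/
theorem theorem2 {C V W : Type} [Countable C] [Infinite C] [Countable V] [Infinite V]
    [Countable W] [Infinite W] [LinearOrder (NatCompletion.Precomputed C)]
    (hord : NatCompletion.StandardOrder C)
    (Pi : NatCompletion.Program C V) (hPi : Pi.Tight)
    (ch : NatCompletion.Choices W Pi)
    (S : Set (NatCompletion.GroundAtom C)) (hS : S ⊆ Pi.herbrandBase) :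
    Pi.IsStableModel S ↔ (NatCompletion.up S).Satisfies (Pi.ncomp ch) := by
  rw [Pi.satisfies_ncomp hord ch S hS]
  constructor
  · intro h
    have hmodel := (Pi.sat_tau_iff S).1 h.1
    refine ⟨fun a => ⟨h.supported, ?_⟩, fun R hR hc θ hb => (hmodel R hR θ hb).1 hc⟩
    -- A supporting basic rule forces its head atom into the model; for a choice rule membership is
    -- part of being supported.
    rintro ⟨R, hR, A, hA | hA, hpred, ⟨θ, hb, ht⟩, hc⟩
    · obtain ⟨p, rs⟩ := a
      cases hpred
      exact (hmodel R hR θ hb).2 A hA rs ht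
    · exact hc hA
  · rintro ⟨hsupp, hcon⟩
    refine hPi.isStableModel hS ((Pi.sat_tau_iff S).2 fun R hR θ hb => ?_)
      fun a => (hsupp a).1
    refine ⟨fun hc => hcon R hR hc θ hb, fun A hA rs hrs => ?_⟩
    exact (hsupp _).2 ⟨R, hR, A, .inl hA, rfl, ⟨θ, hb, hrs⟩, fun h => by
      rw [hA] at h; cases h⟩
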